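/- The following decision problem is undecidable: given a context-free grammar $G$, does $G$ generate a square, i.e., does $L(G)$ contain a word of the form $xx$ with $x$ a non-empty word? That is, no algorithm, given as input a finite description of an arbitrary context-free grammar $G$ (its start variable and its finite list of productions, over finite sets of terminal letters and variables of arbitrary size that are part of the input), always halts and answers correctly whether $L(G)$ contains a square. -/

import Mathlib

/-- A symbol of a grammar description: `Sum.inl a` is the terminal letter with name `a`,
`Sum.inr A` is the variable (nonterminal) with name `A`. -/
abbrev SymbolCode : Type := ℕ ⊕ ℕ

/-- A finite description of a context-free grammar: the name of the start variable together with
the finite list of productions `A → γ`, each given as the pair `(A, γ)`. The letters and the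
variables are named by natural numbers; only finitely many of them occur in one description, and
their number is not bounded in advance. This is a type of finite objects with its standard
(primitive recursive) encoding, so that it can serve as the type of inputs of an algorithm. -/
abbrev CFGCode : Type := ℕ × List (ℕ × List SymbolCode)

/-- The grammar symbol named by a symbol of a description. -/
def SymbolCode.toSymbol : SymbolCode → Symbol ℕ ℕ
  | Sum.inl a => Symbol.terminal a
  | Sum.inr A => Symbol.nonterminal A

/-- The context-free grammar with a given description. -/
def CFGCode.toGrammar (G : CFGCode) : ContextFreeGrammar ℕ where
  NT := ℕ
  initial := G.1
  rules := (G.2.map fun p : ℕ × List SymbolCode =>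
    (⟨p.1, p.2.map SymbolCode.toSymbol⟩ : ContextFreeRule ℕ ℕ)).toFinset

/-- A word is a square if it is of the form `xx` for a nonempty word `x`. -/
def IsSquareWord {α : Type*} (w : List α) : Prop :=
  ∃ x : List α, x ≠ [] ∧ w = x ++ x

/-- The decision problem: the grammar described by `G` generates a square. -/
def GeneratesSquare (G : CFGCode) : Prop :=
  ∃ w ∈ (CFGCode.toGrammar G).language, IsSquareWord w

open Turing Relation

/-! Halting of a fixed Turing machine is word rewriting in a finite semi-Thue system, and a
rewriting sequence is a match in Post's correspondence problem: dominoes carry each word of the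
sequence from one row to its successor in the other row. For a fixed list of dominoes, a linear
grammar generates the row spelled by a sequence of dominoes followed by the mirror image of that
sequence. Write a mark in front of each of two such words, one for either row, and concatenate.
The result is a square exactly when the two words are equal, that is, when both use the same
sequence of dominoes and the rows agree, which is a match. The word on which the machine halts or
not enters the grammar only through the first letters of one row. -/

/-! ### Turing machines with an undecidable halting problem -/

theorem nonempty_primcodable_of_finite (α : Type*) [Finite α] : Nonempty (Primcodable α) := by
  obtain ⟨n, ⟨e⟩⟩ := Finite.exists_equiv_fin α
  exact ⟨Primcodable.ofEquiv (Fin n) e⟩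

theorem natBits_eq_bodd_cons {n : ℕ} (hn : n ≠ 0) : n.bits = n.bodd :: n.div2.bits := by
  have hbit : Nat.bit n.bodd n.div2 = n := Nat.bit_bodd_div2 n
  conv_lhs => rw [← hbit]
  refine Nat.bits_append_bit _ _ fun hdiv => ?_
  by_contra hodd
  exact hn (by rw [← hbit, hdiv, Bool.eq_false_of_not_eq_true hodd]; rfl)

theorem primrec_natBits : Primrec Nat.bits := by
  let step : Unit → List (List Bool) → Option (List Bool) := fun _ bitsBelow =>
    if bitsBelow.length = 0 then some []
    else bitsBelow[bitsBelow.length.div2]?.map (bitsBelow.length.bodd :: ·)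
  have hlen : Primrec fun x : Unit × List (List Bool) => x.2.length :=
    Primrec.list_length.comp Primrec.snd
  have hstep : Primrec₂ step :=
    Primrec.ite (Primrec.eq.comp hlen (Primrec.const 0)) (Primrec.const _)
      (Primrec.option_map
        (Primrec.list_getElem?.comp Primrec.snd (Primrec.nat_div2.comp hlen))
        (Primrec.list_cons.comp (Primrec.nat_bodd.comp (hlen.comp Primrec.fst)) Primrec.snd).to₂)
  refine (Primrec.nat_strong_rec (fun _ : Unit => Nat.bits) hstep fun _ n => ?_).comp
    (Primrec.const ()) Primrec.id
  rcases eq_or_ne n 0 with rfl | hn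
  · simp [step]
  · have hlt : n.div2 < n := by rw [Nat.div2_val]; lia
    simp [step, hn, hlt, natBits_eq_bodd_cons hn]

theorem trNat_eq_map_bits (n : ℕ) :
    PartrecToTM2.trNat n =
      n.bits.map fun b => cond b PartrecToTM2.Γ'.bit1 PartrecToTM2.Γ'.bit0 := by
  induction n using Nat.binaryRec' with
  | zero => simp
  | bit b n hn ih =>
    rw [Nat.bits_append_bit _ _ hn, List.map_cons, ← ih, PartrecToTM2.trNat, PartrecToTM2.trNat,
      ← Num.ofNat'_eq, Num.ofNat'_bit, Num.ofNat'_eq]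
    cases hm : (n : Num) with
    | zero =>
      have h0 : n = 0 := by rw [← Num.to_of_nat n, hm]; rfl
      obtain rfl := hn h0
      rfl
    | pos p => cases b <;> rfl

theorem primrec_trList_singleton [Primcodable PartrecToTM2.Γ'] :
    Primrec fun n : ℕ => PartrecToTM2.trList [n] := by
  let digit : Bool → PartrecToTM2.Γ' := fun b => cond b .bit1 .bit0
  have htrNat : Primrec PartrecToTM2.trNat :=
    (Primrec.list_map primrec_natBits ((Primrec.dom_finite digit).comp Primrec.snd).to₂).of_eq
      fun n => (trNat_eq_map_bits n).symm
  exact Primrec.list_append.comp htrNat (Primrec.const [PartrecToTM2.Γ'.cons])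

theorem primrec_trInit {K : Type*} [DecidableEq K] {Γ : K → Type*} (k : K) [Finite (Γ k)]
    [Primcodable (Γ k)] [Finite (TM2to1.Γ' K Γ)] [Primcodable (TM2to1.Γ' K Γ)] :
    Primrec (TM2to1.trInit (Γ := Γ) k) := by
  let layer : Γ k → TM2to1.Γ' K Γ := fun a => (false, Function.update (fun _ => none) k (some a))
  let markBottom : TM2to1.Γ' K Γ → TM2to1.Γ' K Γ := fun x => (true, x.2)
  have hlayers : Primrec fun L : List (Γ k) => L.reverse.map layer :=
    Primrec.list_map Primrec.list_reverse ((Primrec.dom_finite layer).comp Primrec.snd).to₂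
  exact Primrec.list_cons.comp
    ((Primrec.dom_finite markBottom).comp (Primrec.list_headI.comp hlayers))
    (Primrec.list_tail.comp hlayers)

instance fintypeStackIndex : Fintype PartrecToTM2.K' :=
  ⟨{.main, .rev, .aux, .stack}, fun k => by cases k <;> decide⟩

theorem exists_restrict_eval_dom_iff {Γ Λ : Type*} [Inhabited Γ] [Inhabited Λ]
    {M : TM0.Machine Γ Λ} {S : Set Λ} (hM : TM0.Supports M S) :
    ∃ (_ : Inhabited S) (M' : TM0.Machine Γ S), ∀ l,
      (TM0.eval M' l).Dom ↔ (TM0.eval M l).Dom := by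
  classical
  let _ : Inhabited S := ⟨⟨default, hM.1⟩⟩
  let id' : PointedMap Γ Γ := ⟨id, rfl⟩
  let retract : PointedMap Λ S :=
    ⟨fun q => if h : q ∈ S then ⟨q, h⟩ else default, dif_pos hM.1⟩
  have hretract : ∀ q ∈ S, (retract q : Λ) = q := fun q hq =>
    congrArg Subtype.val (dif_pos hq)
  have hrespects := TM0.Machine.map_respects M id' id' retract Subtype.val hM
    (fun _ => rfl) hretract
  refine ⟨inferInstance, M.map id' id' retract Subtype.val, fun l => ?_⟩
  have hinit : (TM0.init l).map id' retract = TM0.init l := by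
    rw [TM0.map_init]
    exact congrArg TM0.init l.map_id
  simp only [TM0.eval, Part.map_Dom]
  exact StateTransition.tr_eval_dom hrespects ⟨hM.1, hinit⟩

open PartrecToTM2 in
theorem dom_eval_trList (c : ToPartrec.Code) (v : List ℕ) :
    (@TM2.eval K' (fun _ => Γ') Λ' (Option Γ') ⟨trNormal c Cont'.halt⟩ _ _ tr K'.main
      (trList v)).Dom ↔ (c.eval v).Dom := by
  let _ : Inhabited Λ' := ⟨trNormal c Cont'.halt⟩
  have hinit : TM2.init K'.main (trList v) = PartrecToTM2.init c v := by
    simp only [PartrecToTM2.init, TM2.init]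
    congr 1
    funext k
    cases k <;> rfl
  simp only [TM2.eval, Part.map_Dom]
  rw [hinit]
  exact Iff.of_eq (congrArg Part.Dom (PartrecToTM2.tr_eval c v))

theorem exists_code_not_computablePred_dom :
    ∃ c : ToPartrec.Code, ¬ ComputablePred fun n : ℕ => (c.eval [n]).Dom := by
  let f : List.Vector ℕ 1 →. ℕ := fun v => (Denumerable.ofNat Nat.Partrec.Code v.head).eval 0
  have hf : Partrec f := Nat.Partrec.Code.eval_part.comp
    ((Computable.ofNat Nat.Partrec.Code).comp Computable.vector_head) (Computable.const 0)
  obtain ⟨c, hc⟩ := ToPartrec.Code.exists_code (Nat.Partrec'.part_iff.2 hf)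
  have hdom (p : Nat.Partrec.Code) : (p.eval 0).Dom ↔ (c.eval [Encodable.encode p]).Dom := by
    have h : c.eval [Encodable.encode p] = pure <$> f (Encodable.encode p ::ᵥ List.Vector.nil) :=
      hc ⟨[Encodable.encode p], rfl⟩
    simp [h, f]
  exact ⟨c, fun h => ComputablePred.halting_problem 0
    (ComputablePred.computable_of_manyOneReducible ⟨_, Computable.encode, hdom⟩ h)⟩

theorem exists_finite_turingMachine_not_computablePred_dom :
    ∃ (Γ Λ : Type) (_ : Primcodable Γ) (_ : Finite Γ) (_ : Finite Λ) (_ : Inhabited Γ)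
      (_ : Inhabited Λ) (M : TM0.Machine Γ Λ),
      ¬ ComputablePred fun l : List Γ => (TM0.eval M l).Dom := by
  obtain ⟨c, hc⟩ := exists_code_not_computablePred_dom
  let _ : Inhabited PartrecToTM2.Λ' := ⟨PartrecToTM2.trNormal c PartrecToTM2.Cont'.halt⟩
  have hsupports := TM1to0.tr_supports _
    (TM2to1.tr_supports _ (PartrecToTM2.tr_supports c PartrecToTM2.Cont'.halt))
  obtain ⟨_, M, hM⟩ := exists_restrict_eval_dom_iff hsupports
  have : Finite (TM2to1.Γ' PartrecToTM2.K' fun _ => PartrecToTM2.Γ') :=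
    @Finite.of_fintype _ TM2to1.Γ'.fintype
  obtain ⟨_⟩ := nonempty_primcodable_of_finite PartrecToTM2.Γ'
  obtain ⟨_⟩ := nonempty_primcodable_of_finite
    (TM2to1.Γ' PartrecToTM2.K' fun _ => PartrecToTM2.Γ')
  let start (n : ℕ) := TM2to1.trInit (Γ := fun _ => PartrecToTM2.Γ') PartrecToTM2.K'.main
    (PartrecToTM2.trList [n])
  have hstart : Computable start := ((primrec_trInit _).comp primrec_trList_singleton).to_comp
  have hdom (n : ℕ) : (c.eval [n]).Dom ↔ (TM0.eval M (start n)).Dom := by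
    rw [hM, TM1to0.tr_eval]
    exact ((TM2to1.tr_eval_dom _ _ _).trans (dom_eval_trList c [n])).symm
  exact ⟨_, _, inferInstance, inferInstance, Finset.finite_toSet _, inferInstance, inferInstance,
    M, fun h => hc (ComputablePred.computable_of_manyOneReducible ⟨start, hstart, hdom⟩ h)⟩

/-! ### Rewriting -/

/-- One rewriting step of the semi-Thue system (string rewriting system) with rules `R`. -/
def SemiThueStep {α : Type*} (R : Set (List α × List α)) (u v : List α) : Prop :=
  ∃ p l r s, (l, r) ∈ R ∧ u = p ++ l ++ s ∧ v = p ++ r ++ s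

/-- Rewriting in finitely many steps of the semi-Thue system `R`. -/
abbrev SemiThueDerives {α : Type*} (R : Set (List α × List α)) : List α → List α → Prop :=
  ReflTransGen (SemiThueStep R)

/-- The letters of the words that describe configurations of a Turing machine with tape alphabet
`Γ` and states `Λ`: tape symbols, states, two end markers for the written part of the tape, and
`halted`, which replaces the state of a machine that has stopped and then erases the tape. -/
inductive ConfigLetter (Γ Λ : Type*)
  | sym (a : Γ)
  | state (q : Λ)
  | left
  | right
  | halted

namespace ConfigLetter

variable {Γ Λ : Type*}

instance [Finite Γ] [Finite Λ] : Finite (ConfigLetter Γ Λ) :=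
  Finite.of_surjective
    (Sum.elim sym (Sum.elim state ![left, right, halted]) : Γ ⊕ Λ ⊕ Fin 3 → ConfigLetter Γ Λ)
    fun
      | sym a => ⟨.inl a, rfl⟩
      | state q => ⟨.inr (.inl q), rfl⟩
      | left => ⟨.inr (.inr 0), rfl⟩
      | right => ⟨.inr (.inr 1), rfl⟩
      | halted => ⟨.inr (.inr 2), rfl⟩

/-- The word for the part `L` of the tape to the left of the head, listed from the head outwards. -/
def leftWord (L : List Γ) : List (ConfigLetter Γ Λ) :=
  left :: L.reverse.map sym

/-- The word for the part `R` of the tape from the head rightwards. -/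
def rightWord (R : List Γ) : List (ConfigLetter Γ Λ) :=
  R.map sym ++ [right]

/-- The word for the configuration in state `q` with left tape `L` and right tape `R`. -/
def configWord (L : List Γ) (q : Λ) (R : List Γ) : List (ConfigLetter Γ Λ) :=
  leftWord L ++ state q :: rightWord R

theorem leftWord_cons (a : Γ) (L : List Γ) :
    leftWord (Λ := Λ) (a :: L) = leftWord L ++ [sym a] := by
  simp [leftWord]

theorem leftWord_eq_append_sym_iff {L : List Γ} {p : List (ConfigLetter Γ Λ)} {a : Γ} :
    leftWord L = p ++ [sym a] ↔ ∃ L', L = a :: L' ∧ leftWord L' = p := by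
  cases L with
  | nil => cases p <;> simp [leftWord]
  | cons b L => simp [leftWord_cons, ← List.concat_eq_append, List.concat_inj, and_comm]

theorem leftWord_eq_append_left_iff {L : List Γ} {p : List (ConfigLetter Γ Λ)} :
    leftWord L = p ++ [left] ↔ L = [] ∧ p = [] := by
  cases L with
  | nil => cases p <;> simp [leftWord]
  | cons b L => simp [leftWord_cons]

theorem rightWord_eq_sym_cons_iff {R : List Γ} {s : List (ConfigLetter Γ Λ)} {a : Γ} :
    rightWord R = sym a :: s ↔ ∃ R', R = a :: R' ∧ rightWord R' = s := by
  cases R <;> simp [rightWord]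

theorem rightWord_eq_right_cons_iff {R : List Γ} {s : List (ConfigLetter Γ Λ)} :
    rightWord R = right :: s ↔ R = [] ∧ s = [] := by
  cases R <;> simp [rightWord, eq_comm]

theorem configWord_eq_append_state_cons_iff {L R : List Γ} {q q' : Λ}
    {p s : List (ConfigLetter Γ Λ)} :
    configWord L q R = p ++ state q' :: s ↔ leftWord L = p ∧ q = q' ∧ rightWord R = s := by
  rw [configWord, List.append_cons_inj_of_notMem (by simp [leftWord]) (by simp [rightWord])]
  simp

theorem exists_of_configWord_eq_append_state_sym_append {L R : List Γ} {q q' : Λ} {a : Γ}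
    {p s : List (ConfigLetter Γ Λ)} (h : configWord L q R = p ++ [state q', sym a] ++ s) :
    leftWord L = p ∧ q = q' ∧ ∃ R', R = a :: R' ∧ rightWord R' = s := by
  obtain ⟨hL, hq, hR⟩ :=
    (configWord_eq_append_state_cons_iff (s := sym a :: s)).1 (by simpa using h)
  exact ⟨hL, hq, rightWord_eq_sym_cons_iff.1 hR⟩

theorem halted_notMem_configWord (L : List Γ) (q : Λ) (R : List Γ) :
    halted ∉ configWord L q R := by
  simp [configWord, leftWord, rightWord]

end ConfigLetter

section Simulation

open ConfigLetter

variable {Γ Λ : Type*} [Inhabited Γ]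

/-- The configuration described by `configWord L q R`. -/
def configOf (L : List Γ) (q : Λ) (R : List Γ) : TM0.Cfg Γ Λ :=
  ⟨q, Tape.mk' (ListBlank.mk L) (ListBlank.mk R)⟩

theorem listBlank_mk_default : ListBlank.mk [(default : Γ)] = ListBlank.mk [] := by
  simpa using ListBlank.cons_head_tail (ListBlank.mk ([] : List Γ))

theorem configOf_default_right (L : List Γ) (q : Λ) :
    configOf L q [default] = configOf L q [] := by
  simp only [configOf, listBlank_mk_default]

theorem configOf_default_left (q : Λ) (R : List Γ) :
    configOf [default] q R = configOf [] q R := by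
  simp only [configOf, listBlank_mk_default]

variable [Inhabited Λ]

/-- The rules of the semi-Thue system that simulates the machine `M`. -/
inductive SimulationRule (M : TM0.Machine Γ Λ) :
    List (ConfigLetter Γ Λ) → List (ConfigLetter Γ Λ) → Prop
  | padRight (q : Λ) : SimulationRule M [state q, right] [state q, sym default, right]
  | padLeft (q : Λ) : SimulationRule M [left, state q] [left, sym default, state q]
  | moveRight {q a q'} (h : M q a = some (q', .move .right)) :
      SimulationRule M [state q, sym a] [sym a, state q']
  | moveLeft {q a q'} (h : M q a = some (q', .move .left)) (b : Γ) :
      SimulationRule M [sym b, state q, sym a] [state q', sym b, sym a]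
  | write {q a q' b} (h : M q a = some (q', .write b)) :
      SimulationRule M [state q, sym a] [state q', sym b]
  | halt {q a} (h : M q a = none) : SimulationRule M [state q, sym a] [halted]
  | eraseLeft (a : Γ) : SimulationRule M [sym a, halted] [halted]
  | eraseRight (a : Γ) : SimulationRule M [halted, sym a] [halted]

/-- The semi-Thue system that simulates the machine `M`. -/
def simulationRules (M : TM0.Machine Γ Λ) :
    Set (List (ConfigLetter Γ Λ) × List (ConfigLetter Γ Λ)) :=
  {x | SimulationRule M x.1 x.2}

theorem simulationRules_finite [Finite Γ] [Finite Λ] (M : TM0.Machine Γ Λ) :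
    (simulationRules M).Finite := by
  have hshort : {l : List (ConfigLetter Γ Λ) | l.length ≤ 3}.Finite := List.finite_length_le _ 3
  refine (hshort.prod hshort).subset ?_
  rintro ⟨l, r⟩ (_ | _ | _ | _ | _ | _ | _ | _) <;> simp

theorem step_configOf_cons (M : TM0.Machine Γ Λ) (L : List Γ) (q : Λ) (a : Γ) (R : List Γ) :
    TM0.step M (configOf L q (a :: R)) = (M q a).map fun x => ⟨x.1, match x.2 with
      | .move d => (Tape.mk' (ListBlank.mk L) (ListBlank.mk (a :: R))).move d
      | .write b => (Tape.mk' (ListBlank.mk L) (ListBlank.mk (a :: R))).write b⟩ :=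
  rfl

variable {M : TM0.Machine Γ Λ} {L R : List Γ} {q q' : Λ} {a b : Γ}

theorem step_moveRight (h : M q a = some (q', .move .right)) :
    TM0.step M (configOf L q (a :: R)) = some (configOf (a :: L) q' R) := by
  rw [step_configOf_cons, h]
  simp [configOf]

theorem step_moveLeft (h : M q a = some (q', .move .left)) :
    TM0.step M (configOf (b :: L) q (a :: R)) = some (configOf L q' (b :: a :: R)) := by
  rw [step_configOf_cons, h]
  simp [configOf]

theorem step_write (h : M q a = some (q', .write b)) :
    TM0.step M (configOf L q (a :: R)) = some (configOf L q' (b :: R)) := by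
  rw [step_configOf_cons, h]
  simp [configOf]

theorem step_eq_none_iff :
    TM0.step M (configOf L q (a :: R)) = none ↔ M q a = none := by
  rw [step_configOf_cons, Option.map_eq_none_iff]

theorem eval_dom_iff_exists_reaches {l : List Γ} :
    (TM0.eval M l).Dom ↔ ∃ c, TM0.Reaches M (configOf [] default l) c ∧ TM0.step M c = none := by
  rw [TM0.eval, Part.map_Dom, Part.dom_iff_mem]
  exact exists_congr fun c => StateTransition.mem_eval

theorem reaches_or_halts_of_semiThueStep {w : List (ConfigLetter Γ Λ)}
    (h : SemiThueStep (simulationRules M) (configWord L q R) w) :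
    (∃ L' q' R', w = configWord L' q' R' ∧ TM0.Reaches M (configOf L q R) (configOf L' q' R')) ∨
      TM0.step M (configOf L q R) = none := by
  obtain ⟨p, l, r, s, hrule, hsource, rfl⟩ := h
  have hhalted := halted_notMem_configWord L q R
  rcases hrule with q₀ | q₀ | hM | ⟨hM, c⟩ | hM | hM | a | a
  · obtain ⟨rfl, rfl, hR⟩ :=
      (configWord_eq_append_state_cons_iff (s := right :: s)).1 (by simpa using hsource)
    obtain ⟨rfl, rfl⟩ := rightWord_eq_right_cons_iff.1 hR
    refine .inl ⟨L, q, [default], by simp [configWord, rightWord], ?_⟩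
    rw [configOf_default_right]
    exact .refl
  · obtain ⟨hL, rfl, rfl⟩ :=
      (configWord_eq_append_state_cons_iff (p := p ++ [left])).1 (by simpa using hsource)
    obtain ⟨rfl, rfl⟩ := leftWord_eq_append_left_iff.1 hL
    refine .inl ⟨[default], q, R, by simp [configWord, leftWord], ?_⟩
    rw [configOf_default_left]
    exact .refl
  · obtain ⟨rfl, rfl, R, rfl, rfl⟩ := exists_of_configWord_eq_append_state_sym_append hsource
    exact .inl ⟨_, _, _, by simp [configWord, leftWord_cons], .single (step_moveRight hM)⟩
  · obtain ⟨hL, rfl, R, rfl, rfl⟩ :=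
      exists_of_configWord_eq_append_state_sym_append (p := p ++ [sym c]) (by simpa using hsource)
    obtain ⟨L, rfl, rfl⟩ := leftWord_eq_append_sym_iff.1 hL
    exact .inl ⟨_, _, _, by simp [configWord, rightWord], .single (step_moveLeft hM)⟩
  · obtain ⟨rfl, rfl, R, rfl, rfl⟩ := exists_of_configWord_eq_append_state_sym_append hsource
    exact .inl ⟨_, _, _, by simp [configWord, rightWord], .single (step_write hM)⟩
  · obtain ⟨rfl, rfl, R, rfl, rfl⟩ := exists_of_configWord_eq_append_state_sym_append hsource
    exact .inr (step_eq_none_iff.2 hM)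
  all_goals exact absurd (by simp [hsource]) hhalted

theorem reaches_or_dom_of_semiThueDerives {l : List Γ} {w : List (ConfigLetter Γ Λ)}
    (h : SemiThueDerives (simulationRules M) (configWord [] default l) w) :
    (∃ L q R, w = configWord L q R ∧ TM0.Reaches M (configOf [] default l) (configOf L q R)) ∨
      (TM0.eval M l).Dom := by
  induction h with
  | refl => exact .inl ⟨[], default, l, rfl, .refl⟩
  | tail _ hstep ih =>
    rcases ih with ⟨L, q, R, rfl, hreach⟩ | hdom
    · rcases reaches_or_halts_of_semiThueStep hstep with ⟨L', q', R', rfl, hreach'⟩ | hhalts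
      · exact .inl ⟨L', q', R', rfl, hreach.trans hreach'⟩
      · exact .inr (eval_dom_iff_exists_reaches.2 ⟨_, hreach, hhalts⟩)
    · exact .inr hdom

theorem exists_semiThueDerives_pad_right (M : TM0.Machine Γ Λ) (L : List Γ) (q : Λ) (R : List Γ) :
    ∃ a R', configOf L q R = configOf L q (a :: R') ∧
      SemiThueDerives (simulationRules M) (configWord L q R)
        (configWord L q (a :: R')) := by
  cases R with
  | cons a R => exact ⟨a, R, rfl, .refl⟩
  | nil =>
    refine ⟨default, [], (configOf_default_right L q).symm, .single ?_⟩
    refine ⟨leftWord L, _, _, [], .padRight q, ?_, ?_⟩ <;> simp [configWord, rightWord]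

theorem exists_semiThueDerives_pad_left (M : TM0.Machine Γ Λ) (L : List Γ) (q : Λ) (R : List Γ) :
    ∃ b L', configOf L q R = configOf (b :: L') q R ∧
      SemiThueDerives (simulationRules M) (configWord L q R)
        (configWord (b :: L') q R) := by
  cases L with
  | cons b L => exact ⟨b, L, rfl, .refl⟩
  | nil =>
    refine ⟨default, [], (configOf_default_left q R).symm, .single ?_⟩
    refine ⟨[], _, _, rightWord R, .padLeft q, ?_, ?_⟩ <;> simp [configWord, leftWord, rightWord]

theorem semiThueDerives_of_step {c : TM0.Cfg Γ Λ} (h : c ∈ TM0.step M (configOf L q R)) :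
    ∃ L' q' R', c = configOf L' q' R' ∧
      SemiThueDerives (simulationRules M) (configWord L q R)
        (configWord L' q' R') := by
  obtain ⟨a, R, hR, hpad⟩ := exists_semiThueDerives_pad_right M L q R
  rw [hR] at h
  obtain ⟨⟨q', action⟩, haction⟩ : ∃ x, M q a = some x := by
    rw [← Option.ne_none_iff_exists', Ne, ← step_eq_none_iff (L := L) (R := R), h]
    exact Option.some_ne_none c
  rcases action with (_ | _) | b
  · obtain ⟨b, L, hL, hpad'⟩ := exists_semiThueDerives_pad_left M L q (a :: R)
    rw [hL, step_moveLeft haction] at h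
    refine ⟨_, _, _, (Option.some.inj h).symm, (hpad.trans hpad').tail ?_⟩
    refine ⟨leftWord L, _, _, rightWord R, .moveLeft haction b, ?_, ?_⟩ <;>
      simp [configWord, leftWord_cons, rightWord]
  · rw [step_moveRight haction] at h
    refine ⟨_, _, _, (Option.some.inj h).symm, hpad.tail ?_⟩
    refine ⟨leftWord L, _, _, rightWord R, .moveRight haction, ?_, ?_⟩ <;>
      simp [configWord, leftWord_cons, rightWord]
  · rw [step_write haction] at h
    refine ⟨_, _, _, (Option.some.inj h).symm, hpad.tail ?_⟩
    refine ⟨leftWord L, _, _, rightWord R, .write haction, ?_, ?_⟩ <;> simp [configWord, rightWord]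

theorem semiThueDerives_of_reaches {c : TM0.Cfg Γ Λ} (h : TM0.Reaches M (configOf L q R) c) :
    ∃ L' q' R', c = configOf L' q' R' ∧
      SemiThueDerives (simulationRules M) (configWord L q R)
        (configWord L' q' R') := by
  induction h with
  | refl => exact ⟨L, q, R, rfl, .refl⟩
  | tail _ hstep ih =>
    obtain ⟨L', q', R', rfl, h⟩ := ih
    obtain ⟨L'', q'', R'', rfl, h'⟩ := semiThueDerives_of_step hstep
    exact ⟨L'', q'', R'', rfl, h.trans h'⟩

theorem semiThueDerives_erase (M : TM0.Machine Γ Λ) (L R : List Γ) :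
    SemiThueDerives (simulationRules M) (leftWord L ++ halted :: rightWord R)
      [left, halted, right] := by
  induction L with
  | cons a L ih =>
    refine .head ?_ ih
    refine ⟨leftWord L, _, _, rightWord R, .eraseLeft a, ?_, ?_⟩ <;> simp [leftWord_cons]
  | nil =>
    induction R with
    | cons a R ih =>
      refine .head ?_ ih
      refine ⟨[left], _, _, rightWord R, .eraseRight a, ?_, ?_⟩ <;> simp [leftWord, rightWord]
    | nil => exact .refl

theorem semiThueDerives_halted_of_step_eq_none (h : TM0.step M (configOf L q R) = none) :
    SemiThueDerives (simulationRules M) (configWord L q R) [left, halted, right] := by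
  obtain ⟨a, R, hR, hpad⟩ := exists_semiThueDerives_pad_right M L q R
  rw [hR, step_eq_none_iff] at h
  refine (hpad.tail ?_).trans (semiThueDerives_erase M L R)
  refine ⟨leftWord L, _, _, rightWord R, .halt h, ?_, ?_⟩ <;> simp [configWord, rightWord]

theorem eval_dom_iff_semiThueDerives (M : TM0.Machine Γ Λ) (l : List Γ) :
    (TM0.eval M l).Dom ↔
      SemiThueDerives (simulationRules M) (configWord [] default l)
        [left, halted, right] := by
  refine ⟨fun h => ?_, fun h => ?_⟩
  · obtain ⟨c, hreach, hhalts⟩ := eval_dom_iff_exists_reaches.1 h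
    obtain ⟨L, q, R, rfl, hword⟩ := semiThueDerives_of_reaches hreach
    exact hword.trans (semiThueDerives_halted_of_step_eq_none hhalts)
  · refine (reaches_or_dom_of_semiThueDerives h).resolve_left ?_
    rintro ⟨L, q, R, hword, -⟩
    exact halted_notMem_configWord L q R (by simp [← hword])

end Simulation

open ConfigLetter in
theorem primrec_configWord {Γ Λ : Type*} [Finite Γ] [Primcodable Γ]
    [Primcodable (ConfigLetter Γ Λ)] (L : List Γ) (q : Λ) :
    Primrec (configWord L q) := by
  have hright : Primrec (rightWord : List Γ → List (ConfigLetter Γ Λ)) :=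
    Primrec.list_append.comp
      (Primrec.list_map Primrec.id ((Primrec.dom_finite sym).comp Primrec.snd).to₂)
      (Primrec.const [right])
  exact Primrec.list_append.comp (Primrec.const (leftWord L))
    (Primrec.list_cons.comp (Primrec.const (state q)) hright)

theorem exists_semiThueDerives_not_computablePred :
    ∃ (α : Type) (_ : Primcodable α) (_ : Finite α) (R : Set (List α × List α)) (v : List α),
      R.Finite ∧ ¬ ComputablePred fun u => SemiThueDerives R u v := by
  obtain ⟨Γ, Λ, _, _, _, _, _, M, hM⟩ := exists_finite_turingMachine_not_computablePred_dom
  obtain ⟨_⟩ := nonempty_primcodable_of_finite (ConfigLetter Γ Λ)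
  exact ⟨ConfigLetter Γ Λ, inferInstance, inferInstance, simulationRules M, _,
    simulationRules_finite M, fun h => hM (ComputablePred.computable_of_manyOneReducible
      ⟨_, (primrec_configWord [] default).to_comp, eval_dom_iff_semiThueDerives M⟩ h)⟩

/-! ### Post's correspondence problem -/

/-- The form of Post's correspondence problem in which the upper row starts with the word `u` and
the lower row ends with the word `v`: some sequence of dominoes from `P` makes the rows equal. A
domino `d` has upper half `d.2` and lower half `d.1`, so that dominoes read as rewriting rules. -/
def PostMatch {β : Type*} (P : Set (List β × List β)) (u v : List β) : Prop :=
  ∃ σ : List (List β × List β), (∀ d ∈ σ, d ∈ P) ∧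
    u ++ σ.flatMap Prod.snd = σ.flatMap Prod.fst ++ v

section Domino

variable {α : Type*} {R : Set (List α × List α)} {u v : List α}

/-- The word `w` followed by the separator `none`. -/
def terminated (w : List α) : List (Option α) :=
  w.map some ++ [none]

/-- The dominoes whose matches spell out rewriting sequences of the semi-Thue system `R`, with the
words of the sequence separated by `none`. -/
inductive RewriteDomino (R : Set (List α × List α)) : List (Option α) × List (Option α) → Prop
  | separator : RewriteDomino R ([none], [none])
  | copy (a : α) : RewriteDomino R ([some a], [some a])
  | rule {l r} (h : (l, r) ∈ R) : RewriteDomino R (l.map some, r.map some)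

/-- The set of all `RewriteDomino`s of `R`. -/
def rewriteDominoes (R : Set (List α × List α)) : Set (List (Option α) × List (Option α)) :=
  {d | RewriteDomino R d}

theorem rewriteDominoes_finite [Finite α] (hR : R.Finite) : (rewriteDominoes R).Finite := by
  refine ((Set.finite_singleton ([none], [none])).union
    ((Set.finite_range fun a : α => ([some a], [some a])).union
      (hR.image (Prod.map (List.map some) (List.map some))))).subset ?_
  rintro _ (_ | a | h)
  · exact .inl rfl
  · exact .inr (.inl ⟨a, rfl⟩)
  · exact .inr (.inr ⟨_, h, rfl⟩)

theorem exists_dominoes_of_semiThueStep (h : SemiThueStep R u v) :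
    ∃ σ : List (List (Option α) × List (Option α)), (∀ d ∈ σ, d ∈ rewriteDominoes R) ∧
      σ.flatMap Prod.fst = terminated u ∧ σ.flatMap Prod.snd = terminated v := by
  obtain ⟨p, l, r, s, hrule, rfl, rfl⟩ := h
  let copies (w : List α) := w.map fun a => ([some a], [some a])
  have hcopies (w : List α) : ∀ d ∈ copies w, d ∈ rewriteDominoes R :=
    List.forall_mem_map.2 fun a _ => .copy a
  have hfst (w : List α) : (copies w).flatMap Prod.fst = w.map some := by
    simp [copies, List.flatMap_map, ← List.map_eq_flatMap]
  have hsnd (w : List α) : (copies w).flatMap Prod.snd = w.map some := by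
    simp [copies, List.flatMap_map, ← List.map_eq_flatMap]
  refine ⟨copies p ++ (l.map some, r.map some) :: (copies s ++ [([none], [none])]), ?_, ?_, ?_⟩
  · simp only [List.forall_mem_append, List.forall_mem_cons]
    exact ⟨hcopies p, .rule hrule, hcopies s, .separator, by simp⟩
  · simp [hfst, terminated]
  · simp [hsnd, terminated]

theorem postMatch_of_semiThueDerives (h : SemiThueDerives R u v) :
    PostMatch (rewriteDominoes R) (terminated u) (terminated v) := by
  induction h using ReflTransGen.head_induction_on with
  | refl => exact ⟨[], by simp, by simp⟩
  | head hstep _ ih =>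
    obtain ⟨σ, hσ, hfst, hsnd⟩ := exists_dominoes_of_semiThueStep hstep
    obtain ⟨τ, hτ, hmatch⟩ := ih
    refine ⟨σ ++ τ, List.forall_mem_append.2 ⟨hσ, hτ⟩, ?_⟩
    rw [List.flatMap_append, List.flatMap_append, hfst, hsnd, hmatch, List.append_assoc]

theorem exists_of_terminated_append_eq {p l : List α} {x y : List (Option α)}
    (h : terminated p ++ x = l.map some ++ y) : ∃ p', p = l ++ p' ∧ y = terminated p' ++ x := by
  induction l generalizing p with
  | nil => exact ⟨p, rfl, h.symm⟩
  | cons a l ih =>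
    cases p with
    | nil => simp [terminated] at h
    | cons b p =>
      obtain ⟨rfl, htail⟩ : b = a ∧ terminated p ++ x = l.map some ++ y := by
        simpa [terminated] using h
      obtain ⟨p', rfl, rfl⟩ := ih htail
      exact ⟨p', rfl, rfl⟩

-- `p` is the part of the current word not yet copied or rewritten, `c` the next word so far.
theorem semiThueDerives_of_dominoes {σ : List (List (Option α) × List (Option α))}
    (hσ : ∀ d ∈ σ, d ∈ rewriteDominoes R) {p c : List α}
    (h : terminated p ++ (c.map some ++ σ.flatMap Prod.snd) =
      σ.flatMap Prod.fst ++ terminated v) :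
    SemiThueDerives R (c ++ p) v := by
  induction σ generalizing p c with
  | nil =>
    obtain ⟨rfl, rfl⟩ : p = v ∧ c = [] := by
      have hsplit : p.map some ++ none :: c.map some = v.map some ++ none :: [] := by
        simpa [terminated] using h
      rw [List.append_cons_inj_of_notMem (by simp) (by simp)] at hsplit
      simpa [(Option.some_injective α).list_map.eq_iff] using hsplit
    exact .refl
  | cons d σ ih =>
    obtain ⟨hd, hσ'⟩ := List.forall_mem_cons.1 hσ
    simp only [List.flatMap_cons, List.append_assoc] at h
    rcases hd with _ | a | @⟨l, r, hrule⟩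
    · cases p with
      | nil =>
        simpa using ih hσ' (p := c) (c := []) (by simpa [terminated] using h)
      | cons a p => simp [terminated] at h
    · obtain ⟨p', rfl, htail⟩ := exists_of_terminated_append_eq (l := [a]) h
      simpa using ih hσ' (p := p') (c := c ++ [a]) (by simpa using htail.symm)
    · obtain ⟨p', rfl, htail⟩ := exists_of_terminated_append_eq h
      refine .head ⟨c, l, r, p', hrule, by simp, rfl⟩
        (ih hσ' (p := p') (c := c ++ r) (by simpa using htail.symm))

theorem postMatch_rewriteDominoes_iff :
    PostMatch (rewriteDominoes R) (terminated u) (terminated v) ↔ SemiThueDerives R u v := by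
  refine ⟨?_, postMatch_of_semiThueDerives⟩
  rintro ⟨σ, hσ, hmatch⟩
  exact semiThueDerives_of_dominoes (c := []) hσ hmatch

end Domino

theorem primrec_terminated {α : Type*} [Primcodable α] :
    Primrec (terminated : List α → List (Option α)) :=
  Primrec.list_append.comp (Primrec.list_map Primrec.id (Primrec.option_some.comp Primrec.snd).to₂)
    (Primrec.const [none])

theorem exists_postMatch_not_computablePred :
    ∃ (β : Type) (_ : Primcodable β) (P : List (List β × List β)) (v : List β),
      ¬ ComputablePred fun u => PostMatch {d | d ∈ P} u v := by
  obtain ⟨α, _, _, R, v, hR, h⟩ := exists_semiThueDerives_not_computablePred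
  have hfinite := rewriteDominoes_finite hR
  have hP : {d | d ∈ hfinite.toFinset.toList} = rewriteDominoes R := by ext; simp
  refine ⟨Option α, inferInstance, hfinite.toFinset.toList, terminated v, fun hc => h ?_⟩
  rw [hP] at hc
  exact ComputablePred.computable_of_manyOneReducible
    ⟨terminated, primrec_terminated.to_comp, fun u => postMatch_rewriteDominoes_iff.symm⟩ hc

/-! ### Squares in context-free languages -/

section Interpretation

variable {T N : Type*}

/-- The language of a sentential form in which every nonterminal `A` is read as the language `I A`.
A grammar whose productions respect `I` generates a language below `I` of its start symbol. -/
def interpretation (I : N → Language T) (γ : List (Symbol T N)) : Language T :=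
  (γ.map fun
    | .terminal a => ({[a]} : Language T)
    | .nonterminal A => I A).prod

variable {I : N → Language T}

theorem interpretation_append (γ δ : List (Symbol T N)) :
    interpretation I (γ ++ δ) = interpretation I γ * interpretation I δ := by
  simp [interpretation]

theorem interpretation_nonterminal (A : N) : interpretation I [.nonterminal A] = I A := by
  simp [interpretation]

theorem interpretation_terminals (w : List T) :
    interpretation I (w.map .terminal) = {w} := by
  induction w with
  | nil => rfl
  | cons a w ih =>
    calc interpretation I ((a :: w).map .terminal)
        = {[a]} * interpretation I (w.map .terminal) := by simp [interpretation]
      _ = {a :: w} := by rw [ih]; exact Set.image2_singleton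

theorem interpretation_le_of_derives {g : ContextFreeGrammar T} {I : g.NT → Language T}
    (hI : ∀ r ∈ g.rules, interpretation I r.output ≤ I r.input) {γ δ : List (Symbol T g.NT)}
    (h : g.Derives γ δ) : interpretation I δ ≤ interpretation I γ := by
  induction h with
  | refl => exact le_rfl
  | tail _ hproduces ih =>
    obtain ⟨r, hr, hrewrites⟩ := hproduces
    obtain ⟨p, s, rfl, rfl⟩ := hrewrites.exists_parts
    refine le_trans ?_ ih
    simp only [interpretation_append, interpretation_nonterminal]
    gcongr
    exact hI r hr

theorem language_le_of_interpretation_le {g : ContextFreeGrammar T} {I : g.NT → Language T}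
    (hI : ∀ r ∈ g.rules, interpretation I r.output ≤ I r.input) :
    g.language ≤ I g.initial := by
  intro w hw
  have hle := interpretation_le_of_derives hI (g.mem_language_iff w |>.1 hw)
  rw [interpretation_terminals, interpretation_nonterminal] at hle
  exact hle rfl

end Interpretation

namespace CFGCode

variable {G : CFGCode}

theorem mem_rules {r : ContextFreeRule ℕ ℕ} :
    r ∈ G.toGrammar.rules ↔ ∃ p ∈ G.2, ⟨p.1, p.2.map SymbolCode.toSymbol⟩ = r :=
  List.mem_toFinset.trans List.mem_map

theorem derives_of_mem {A : ℕ} {γ : List SymbolCode} (h : (A, γ) ∈ G.2)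
    {δ : List (Symbol ℕ ℕ)} (hδ : γ.map SymbolCode.toSymbol = δ) :
    G.toGrammar.Derives [.nonterminal A] δ :=
  .single ⟨_, mem_rules.2 ⟨_, h, rfl⟩, hδ ▸ ContextFreeRule.Rewrites.input_output⟩

theorem language_le {I : ℕ → Language ℕ}
    (hI : ∀ p ∈ G.2, interpretation I (p.2.map SymbolCode.toSymbol) ≤ I p.1) :
    G.toGrammar.language ≤ I G.1 := by
  refine language_le_of_interpretation_le (g := G.toGrammar) fun r hr => ?_
  obtain ⟨p, hp, rfl⟩ := mem_rules.1 hr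
  exact hI p hp

end CFGCode

theorem map_toSymbol_map_inl (w : List ℕ) :
    (w.map Sum.inl).map SymbolCode.toSymbol = w.map .terminal := by
  rw [List.map_map]
  rfl

theorem map_toSymbol_map_inl_append_inr (x y : List ℕ) (A : ℕ) :
    (x.map Sum.inl ++ Sum.inr A :: y.map Sum.inl).map SymbolCode.toSymbol =
      x.map .terminal ++ ([.nonterminal A] ++ y.map .terminal) := by
  rw [List.map_append, List.map_cons, map_toSymbol_map_inl, map_toSymbol_map_inl]
  rfl

section Match

variable {α β : Type*} [Encodable α] [Encodable β]

/-- The terminals `x + 2` stand for letters of domino words and for dominoes; the terminals `0` and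
`1` are kept as marks. -/
def terminalCode (x : α) : ℕ :=
  Encodable.encode x + 2

theorem terminalCode_injective : Function.Injective (terminalCode (α := α)) :=
  (add_left_injective 2).comp Encodable.encode_injective

theorem notMem_map_terminalCode {n : ℕ} (hn : n < 2) (w : List α) : n ∉ w.map terminalCode := by
  simp only [List.mem_map, terminalCode, not_exists, not_and]
  lia

/-- The halves `f d` of the dominoes `d` in `σ`, the word `z`, the mark `1`, and then `σ` itself, in
reverse order so that the words of this form are generated by linear productions. -/
def matchWord (f : α → List β) (z : List β) (σ : List α) : List ℕ :=
  (σ.flatMap f ++ z).map terminalCode ++ 1 :: σ.reverse.map terminalCode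

/-- The words `matchWord f z σ` for sequences `σ` of dominoes in `P`. -/
def matchLanguage (f : α → List β) (z : List β) (P : List α) : Language ℕ :=
  {w | ∃ σ : List α, (∀ d ∈ σ, d ∈ P) ∧ matchWord f z σ = w}

/-- The productions generating `matchLanguage f z P` from the nonterminal `A`. -/
def matchProductions (A : ℕ) (f : α → List β) (z : List β) (P : List α) :
    List (ℕ × List SymbolCode) :=
  (A, (z.map terminalCode ++ [1]).map .inl) ::
    P.map fun d => (A, ((f d).map terminalCode).map .inl ++ .inr A :: [terminalCode d].map .inl)

variable {A : ℕ} {f : α → List β} {z : List β} {P σ : List α}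

theorem matchWord_nil : matchWord f z [] = z.map terminalCode ++ [1] := rfl

theorem matchWord_cons (d : α) :
    matchWord f z (d :: σ) = (f d).map terminalCode ++ (matchWord f z σ ++ [terminalCode d]) := by
  simp [matchWord]

theorem zero_notMem_matchWord : 0 ∉ matchWord f z σ := by
  simp only [matchWord, List.mem_append, List.mem_cons, not_or]
  exact ⟨notMem_map_terminalCode two_pos _, zero_ne_one, notMem_map_terminalCode two_pos _⟩

theorem matchWord_eq_append_matchWord_iff {g : α → List β} {u : List β} {τ : List α} :
    matchWord f z σ = u.map terminalCode ++ matchWord g [] τ ↔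
      σ = τ ∧ u ++ τ.flatMap g = σ.flatMap f ++ z := by
  rw [matchWord, matchWord, ← List.append_assoc, ← List.map_append,
    List.append_cons_inj_of_notMem (notMem_map_terminalCode one_lt_two _)
      (notMem_map_terminalCode one_lt_two _),
    terminalCode_injective.list_map.eq_iff, terminalCode_injective.list_map.eq_iff,
    List.reverse_inj, List.append_nil]
  tauto

theorem derives_matchWord {G : CFGCode} (hG : matchProductions A f z P ⊆ G.2)
    (hσ : ∀ d ∈ σ, d ∈ P) :
    G.toGrammar.Derives [.nonterminal A] ((matchWord f z σ).map .terminal) := by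
  induction σ with
  | nil => exact CFGCode.derives_of_mem (hG List.mem_cons_self) (map_toSymbol_map_inl _)
  | cons d σ ih =>
    obtain ⟨hd, hσ⟩ := List.forall_mem_cons.1 hσ
    have hproduction := CFGCode.derives_of_mem
      (hG (List.mem_cons_of_mem _ (List.mem_map_of_mem hd))) (map_toSymbol_map_inl_append_inr _ _ _)
    rw [matchWord_cons, List.map_append, List.map_append]
    exact hproduction.trans (((ih hσ).append_right _).append_left _)

theorem interpretation_matchProductions_le {I : ℕ → Language ℕ}
    (hI : I A = matchLanguage f z P) {p : ℕ × List SymbolCode}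
    (hp : p ∈ matchProductions A f z P) :
    interpretation I (p.2.map SymbolCode.toSymbol) ≤ I p.1 := by
  rcases List.mem_cons.1 hp with rfl | hp
  · rw [map_toSymbol_map_inl, interpretation_terminals, hI]
    rintro _ rfl
    exact ⟨[], by simp, matchWord_nil⟩
  · obtain ⟨d, hd, rfl⟩ := List.mem_map.1 hp
    rw [map_toSymbol_map_inl_append_inr, interpretation_append, interpretation_append,
      interpretation_terminals, interpretation_terminals, interpretation_nonterminal, hI]
    rintro _ ⟨_, rfl, _, ⟨_, ⟨σ, hσ, rfl⟩, _, rfl, rfl⟩, rfl⟩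
    exact ⟨d :: σ, List.forall_mem_cons.2 ⟨hd, hσ⟩, matchWord_cons d⟩

end Match

theorem isSquareWord_cons_append_cons_iff {α : Type*} {a : α} {x y : List α} (hx : a ∉ x)
    (hy : a ∉ y) : IsSquareWord (a :: x ++ a :: y) ↔ x = y := by
  refine ⟨?_, fun h => ⟨a :: x, List.cons_ne_nil _ _, by rw [h]⟩⟩
  rintro ⟨_ | ⟨b, z⟩, hne, h⟩
  · exact absurd rfl hne
  · obtain ⟨rfl, htail⟩ := List.cons.inj h
    obtain ⟨rfl, -, rfl⟩ := (List.append_cons_inj_of_notMem hx hy).1 htail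
    rfl

section SquareGrammar

variable {β : Type*} [Encodable β] {P : List (List β × List β)} {u v : List β}

/-- The right-hand side `0 A 0 u B` of the start production of `squareGrammar`, where `A` and `B`
are the variables `1` and `2`. -/
def squareStart (u : List β) : List SymbolCode :=
  .inl 0 :: .inr 1 :: ((0 :: u.map terminalCode).map .inl ++ [.inr 2])

/-- A grammar in which the start variable `0` generates the words `0 x 0 u y` with `x` derived from
the variable `1`, which spells lower rows of `PostMatch` ending with `v`, and `y` derived from the
variable `2`, which spells upper rows without the initial word `u`. -/
def squareGrammar (P : List (List β × List β)) (v u : List β) : CFGCode :=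
  (0, (0, squareStart u) :: (matchProductions 1 Prod.fst v P ++ matchProductions 2 Prod.snd [] P))

/-- The language of `squareGrammar P v u`. -/
def squareLanguage (P : List (List β × List β)) (v u : List β) : Language ℕ :=
  {[0]} * matchLanguage Prod.fst v P *
    ({0 :: u.map terminalCode} * matchLanguage Prod.snd [] P)

theorem mem_squareLanguage {w : List ℕ} :
    w ∈ squareLanguage P v u ↔ ∃ σ τ, (∀ d ∈ σ, d ∈ P) ∧ (∀ d ∈ τ, d ∈ P) ∧
      0 :: matchWord Prod.fst v σ ++ 0 :: (u.map terminalCode ++ matchWord Prod.snd [] τ) = w := by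
  constructor
  · rintro ⟨_, ⟨_, rfl, _, ⟨σ, hσ, rfl⟩, rfl⟩, _, ⟨_, rfl, _, ⟨τ, hτ, rfl⟩, rfl⟩, rfl⟩
    exact ⟨σ, τ, hσ, hτ, rfl⟩
  · rintro ⟨σ, τ, hσ, hτ, rfl⟩
    exact ⟨_, ⟨_, rfl, _, ⟨σ, hσ, rfl⟩, rfl⟩, _, ⟨_, rfl, _, ⟨τ, hτ, rfl⟩, rfl⟩, rfl⟩

theorem map_toSymbol_squareStart :
    (squareStart u).map SymbolCode.toSymbol = [0].map .terminal ++ [.nonterminal 1] ++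
      ((0 :: u.map terminalCode).map .terminal ++ [.nonterminal 2]) := by
  rw [← map_toSymbol_map_inl, ← map_toSymbol_map_inl]
  simp [squareStart, SymbolCode.toSymbol]

theorem squareGrammar_language_le :
    (squareGrammar P v u).toGrammar.language ≤ squareLanguage P v u := by
  let I : ℕ → Language ℕ
    | 0 => squareLanguage P v u
    | 1 => matchLanguage Prod.fst v P
    | _ => matchLanguage Prod.snd [] P
  refine CFGCode.language_le (I := I) fun p hp => ?_
  rcases List.mem_cons.1 hp with rfl | hp
  · simp only [map_toSymbol_squareStart, interpretation_append, interpretation_terminals,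
      interpretation_nonterminal]
    exact le_rfl
  · rcases List.mem_append.1 hp with hp | hp
    · exact interpretation_matchProductions_le rfl hp
    · exact interpretation_matchProductions_le rfl hp

theorem squareLanguage_le_squareGrammar_language :
    squareLanguage P v u ≤ (squareGrammar P v u).toGrammar.language := by
  intro w hw
  obtain ⟨σ, τ, hσ, hτ, rfl⟩ := mem_squareLanguage.1 hw
  let G := squareGrammar P v u
  have hstart : G.toGrammar.Derives [.nonterminal (0 : ℕ)] _ :=
    CFGCode.derives_of_mem List.mem_cons_self map_toSymbol_squareStart
  have hfirst : G.toGrammar.Derives [.nonterminal (1 : ℕ)] _ := derives_matchWord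
    (List.subset_cons_of_subset _ (List.subset_append_left _ _)) hσ
  have hsecond : G.toGrammar.Derives [.nonterminal (2 : ℕ)] _ := derives_matchWord
    (List.subset_cons_of_subset _ (List.subset_append_right _ _)) hτ
  have hderives : G.toGrammar.Derives [.nonterminal (0 : ℕ)]
      (([0] ++ matchWord Prod.fst v σ ++
        (0 :: u.map terminalCode ++ matchWord Prod.snd [] τ)).map .terminal) := by
    rw [List.map_append, List.map_append, List.map_append]
    exact hstart.trans (((hfirst.append_left _).append_right _).trans
      ((hsecond.append_left _).append_left _))
  exact hderives

theorem squareGrammar_language :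
    (squareGrammar P v u).toGrammar.language = squareLanguage P v u :=
  le_antisymm squareGrammar_language_le squareLanguage_le_squareGrammar_language

theorem isSquareWord_matchWords_iff {σ τ : List (List β × List β)} :
    IsSquareWord (0 :: matchWord Prod.fst v σ ++
      0 :: (u.map terminalCode ++ matchWord Prod.snd [] τ)) ↔
      σ = τ ∧ u ++ τ.flatMap Prod.snd = σ.flatMap Prod.fst ++ v := by
  rw [isSquareWord_cons_append_cons_iff zero_notMem_matchWord, matchWord_eq_append_matchWord_iff]
  exact List.not_mem_append (notMem_map_terminalCode two_pos _) zero_notMem_matchWord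

theorem generatesSquare_squareGrammar_iff :
    GeneratesSquare (squareGrammar P v u) ↔ PostMatch {d | d ∈ P} u v := by
  rw [GeneratesSquare, squareGrammar_language]
  constructor
  · rintro ⟨w, hw, hsquare⟩
    obtain ⟨σ, τ, hσ, -, rfl⟩ := mem_squareLanguage.1 hw
    obtain ⟨rfl, hmatch⟩ := isSquareWord_matchWords_iff.1 hsquare
    exact ⟨σ, hσ, hmatch⟩
  · rintro ⟨σ, hσ, hmatch⟩
    exact ⟨_, mem_squareLanguage.2 ⟨σ, σ, hσ, hσ, rfl⟩, isSquareWord_matchWords_iff.2 ⟨rfl, hmatch⟩⟩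

end SquareGrammar

theorem primrec_terminalCode {α : Type*} [Primcodable α] :
    Primrec (terminalCode : α → ℕ) :=
  Primrec.nat_add.comp Primrec.encode (Primrec.const 2)

theorem primrec_squareStart {β : Type*} [Primcodable β] :
    Primrec (squareStart : List β → List SymbolCode) := by
  have hcodes : Primrec fun u : List β => (0 :: u.map terminalCode).map (.inl : ℕ → SymbolCode) :=
    Primrec.list_map (Primrec.list_cons.comp (Primrec.const 0)
      (Primrec.list_map Primrec.id (primrec_terminalCode.comp Primrec.snd).to₂))
      (Primrec.sumInl.comp₂ Primrec₂.right)
  exact Primrec.list_cons.comp (Primrec.const _) (Primrec.list_cons.comp (Primrec.const _)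
    (Primrec.list_append.comp hcodes (Primrec.const _)))

theorem primrec_squareGrammar {β : Type*} [Primcodable β] (P : List (List β × List β))
    (v : List β) : Primrec (squareGrammar P v) :=
  Primrec.pair (Primrec.const 0) (Primrec.list_cons.comp
    (Primrec.pair (Primrec.const 0) primrec_squareStart) (Primrec.const _))

theorem theorem4 : ¬ ComputablePred (fun G : CFGCode => GeneratesSquare G) := by
  obtain ⟨β, _, P, v, h⟩ := exists_postMatch_not_computablePred
  exact fun hc => h (ComputablePred.computable_of_manyOneReducible
    ⟨squareGrammar P v, (primrec_squareGrammar P v).to_comp,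
      fun _ => generatesSquare_squareGrammar_iff.symm⟩ hc)
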